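/- Let $1\le k\le n$. In $\mathbb{Q}[x_1,\dots,x_n]$ let $e_d$ be the degree-$d$ elementary symmetric polynomial in $x_1,\dots,x_n$, and let $e_d^{(i)}$ be the degree-$d$ elementary symmetric polynomial in the variables $x_1,\dots,x_{i-1},x_{i+1},\dots,x_n$ (so $e_0^{(i)}=1$, and $e_d^{(i)}=0$ for $d<0$). Put $$J_{n,k}=\big\langle x_i^d\, e_{n-r}^{(i)} : 1\le i\le n,\ 1\le r\le d\big\rangle+\langle e_n,e_{n-1},\dots,e_{n-k+1}\rangle,\qquad S_{n,k}=\mathbb{Q}[x_1,\dots,x_n]/J_{n,k}.$$ For an ordered set partition $\sigma=(B_1\mid\cdots\mid B_\ell)$ of $[n]=\{1,\dots,n\}$ into nonempty blocks, its boosted coinversion code is the sequence $(c_1,\dots,c_n)$ given, for $i\in B_j$, by $$c_i=\begin{cases}|\{m>j:\min(B_m)>i\}| & \text{if } i=\min(B_j),\\ |\{m>j:\min(B_m)>i\}|+j & \text{if } i\ne\min(B_j).\end{cases}$$ Order monomials lexicographically with $x_n>x_{n-1}>\cdots>x_1$: for $a\neq b$, $x^a<x^b$ if and only if $a_j<b_j$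 for the largest index $j$ with $a_j\ne b_j$. The standard monomials of $S_{n,k}$ are the monomials that do not lie in the ideal generated by the leading monomials of all nonzero elements of $J_{n,k}$. Then the set of standard monomials of $S_{n,k}$ is exactly the set of monomials $x_1^{c_1}\cdots x_n^{c_n}$ where $(c_1,\dots,c_n)$ is the boosted coinversion code of some ordered set partition of $[n]$ with at least $k$ blocks, and the images of these monomials form a $\mathbb{Q}$-basis of $S_{n,k}$. -/

import Mathlib

namespace StdMonomials

open MvPolynomial

/-! ### Ordered set partitions and boosted coinversion codes

The ground set `[n] = {1, …, n}` is modelled by `Fin n` and block positions `1, …, ℓ` by `Fin ℓ`,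
so the (one-based) position of the block `j : Fin ℓ` is `j + 1`. -/

/-- An ordered set partition `(B₁ ∣ ⋯ ∣ B_ℓ)` of `[n]` into `ℓ` blocks. -/
structure OrderedSetPartition (n ℓ : ℕ) where
  /-- the sequence of blocks -/
  block : Fin ℓ → Finset (Fin n)
  block_nonempty : ∀ j, (block j).Nonempty
  existsUnique_mem : ∀ i, ∃! j, i ∈ block j

namespace OrderedSetPartition

variable {n ℓ : ℕ} (σ : OrderedSetPartition n ℓ)

/-- The (zero-based) position of the block that contains `i`. -/
noncomputable def blockIndex (i : Fin n) : Fin ℓ :=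
  (σ.existsUnique_mem i).choose

theorem mem_block_blockIndex (i : Fin n) : i ∈ σ.block (σ.blockIndex i) :=
  (σ.existsUnique_mem i).choose_spec.1

theorem blockIndex_eq {i : Fin n} {j : Fin ℓ} (h : i ∈ σ.block j) : σ.blockIndex i = j :=
  ((σ.existsUnique_mem i).choose_spec.2 j h).symm

/-- The minimum `min(B_j)` of a block. -/
def blockMin (j : Fin ℓ) : Fin n :=
  (σ.block j).min' (σ.block_nonempty j)

/-- The boosted coinversion code: for `i ∈ B_j`, the entry `c_i` is
`#{l > j : min(B_l) > i}` if `i = min(B_j)`, and `#{l > j : min(B_l) > i} + j` otherwise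
(where `j` is the one-based position of the block). -/
noncomputable def boostedCode (i : Fin n) : ℕ :=
  (Finset.univ.filter fun l : Fin ℓ => σ.blockIndex i < l ∧ i < σ.blockMin l).card +
    if i = σ.blockMin (σ.blockIndex i) then 0 else (σ.blockIndex i : ℕ) + 1

end OrderedSetPartition

/-! ### The ideal `J_{n,k}` and the quotient ring `S_{n,k}` -/

/-- `e_d^{(i)}`: the elementary symmetric polynomial of degree `d` in the variables
`x_1, …, x_n` with `x_i` omitted. -/
noncomputable def esymmOmit (n : ℕ) (i : Fin n) (d : ℕ) : MvPolynomial (Fin n) ℚ :=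
  ∑ s ∈ (Finset.univ.erase i).powersetCard d, ∏ j ∈ s, X j

/-- `J_n = ⟨x_i^d · e_{n-r}^{(i)} : 1 ≤ i ≤ n, 1 ≤ r ≤ d⟩`. As elementary symmetric polynomials
of negative degree vanish, only the generators with `r ≤ n` are listed. -/
noncomputable def idealJ₀ (n : ℕ) : Ideal (MvPolynomial (Fin n) ℚ) :=
  Ideal.span {p | ∃ (i : Fin n) (d r : ℕ), 1 ≤ r ∧ r ≤ d ∧ r ≤ n ∧
    p = X i ^ d * esymmOmit n i (n - r)}

/-- `J_{n,k} = J_n + ⟨e_n, e_{n-1}, …, e_{n-k+1}⟩`. -/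
noncomputable def idealJ (n k : ℕ) : Ideal (MvPolynomial (Fin n) ℚ) :=
  idealJ₀ n ⊔ Ideal.span {p | ∃ d : ℕ, n + 1 ≤ d + k ∧ d ≤ n ∧ p = esymm (Fin n) ℚ d}

/-- `S_{n,k} = ℚ[x_1, …, x_n] / J_{n,k}`. -/
abbrev QuotientS (n k : ℕ) : Type := MvPolynomial (Fin n) ℚ ⧸ idealJ n k

/-! ### Lexicographic order and standard monomials -/

/-- The lexicographic monomial order on `x_1, …, x_n` with `x_n > x_{n-1} > ⋯ > x_1`:
exponent vectors are compared at the largest index at which they differ. -/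
noncomputable def lexOrder (n : ℕ) : MonomialOrder (Fin n) where
  syn := Lex ((Fin n)ᵒᵈ →₀ ℕ)
  toSyn := (Finsupp.domCongr (OrderDual.toDual : Fin n ≃ (Fin n)ᵒᵈ)).trans
    { toEquiv := toLex, map_add' := toLex_add }
  toSyn_monotone := fun _ _ h => Finsupp.toLex_monotone fun i => h (OrderDual.ofDual i)

theorem lexOrder_lt_iff {n : ℕ} {a b : Fin n →₀ ℕ} :
    (lexOrder n).toSyn a < (lexOrder n).toSyn b ↔
      ∃ j, (∀ i, j < i → a i = b i) ∧ a j < b j :=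
  Iff.rfl

/-- The ideal `LM(I)` generated by the leading monomials of all nonzero `f ∈ I`. -/
noncomputable def leadingMonomialIdeal {n : ℕ} (m : MonomialOrder (Fin n))
    (I : Ideal (MvPolynomial (Fin n) ℚ)) : Ideal (MvPolynomial (Fin n) ℚ) :=
  Ideal.span {p | ∃ f ∈ I, f ≠ 0 ∧ p = monomial (m.degree f) 1}

/-- The standard monomials of `ℚ[x_1, …, x_n] / I`: the monomials that are not in `LM(I)`. -/
def standardMonomials {n : ℕ} (m : MonomialOrder (Fin n))
    (I : Ideal (MvPolynomial (Fin n) ℚ)) : Set (MvPolynomial (Fin n) ℚ) :=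
  {p | (∃ c : Fin n →₀ ℕ, p = monomial c 1) ∧ p ∉ leadingMonomialIdeal m I}

/-- The monomials `x_1^{c_1} ⋯ x_n^{c_n}` where `(c_1, …, c_n)` is the boosted coinversion code of
some ordered set partition of `[n]` with at least `k` blocks. -/
def codeMonomials (n k : ℕ) : Set (MvPolynomial (Fin n) ℚ) :=
  {p | ∃ (ℓ : ℕ) (σ : OrderedSetPartition n ℓ), k ≤ ℓ ∧ p = ∏ i, X i ^ σ.boostedCode i}

end StdMonomials

/-!
Let `c` be an exponent vector. Going through the indices from the largest to the smallest and
putting `i` into `A` when `c i` is at most the number of elements of `A` already chosen yields the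
only possible set `A` of block minima. If `k ≤ |A|` and all entries of `c` are at most `|A|`, then
`c` is a boosted coinversion code: the minima, and then the other elements, can be placed one at a
time. Otherwise `x ^ c` is a multiple of the leading monomial of a flagged Jacobi–Trudi determinant,
possibly multiplied by a power of a variable. That product lies in `J_{n,k}` by Cramer's rule: the
identities `∑ (-1) ^ (d - j) e_j(s ∪ t) h_{d - j}(s) = e_d(t) = 0` for `d > |t|` show that the
matrix sends the vector of the `e_j`, one of whose entries is `e_0 = 1`, into elementary symmetric
polynomials of high degree. Hence every standard monomial is a code monomial.

Equality follows by counting (orbit harmonics). Attach to an ordered set partition the point of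
`ℚ ^ n` listing the block positions of `1, …, n`. Each generator of `J_{n,k}` is the top degree form
of a polynomial vanishing at all these points, so the standard monomials, which span the quotient by
`J_{n,k}`, also span the functions on the points. There are therefore at least as many standard
monomials as ordered set partitions, hence as code monomials.
-/

namespace StdMonomials

open MvPolynomial
open Finset.HasAntidiagonal (antidiagonal)

/-! ### Elementary and complete homogeneous symmetric functions -/

section SymmetricFunctions

variable {A : Type*} [CommRing A]

/-- `(-1) ^ d * h_d(s)`, where `h_d` is the complete homogeneous symmetric function of degree `d`.
It is encoded as the coefficient of `T ^ d` in the power series `∏ a ∈ s, (1 + a * T)⁻¹`. -/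
noncomputable def signedHsymm (s : Multiset A) (d : ℕ) : A :=
  PowerSeries.coeff d (s.map fun a => PowerSeries.mk fun b => (-a) ^ b).prod

theorem coeff_prod_one_add_C_mul_X (s : Multiset A) (d : ℕ) :
    PowerSeries.coeff d (s.map fun a => 1 + PowerSeries.C a * PowerSeries.X).prod = s.esymm d := by
  induction s using Multiset.induction_on generalizing d with
  | empty => cases d <;> simp [Multiset.esymm, PowerSeries.coeff_one,
      Multiset.powersetCard_zero_right]
  | cons a s ih =>
    cases d with
    | zero =>
      simpa [add_mul, mul_assoc, Multiset.esymm] using ih 0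
    | succ d =>
      simp [add_mul, mul_assoc, PowerSeries.coeff_succ_X_mul, ih, Multiset.esymm,
        Multiset.powersetCard_cons, Multiset.sum_map_mul_left]

theorem one_add_C_mul_X_mul_geom (a : A) :
    (1 + PowerSeries.C a * PowerSeries.X) * PowerSeries.mk (fun b => (-a) ^ b) = 1 := by
  ext d
  cases d with
  | zero => simp
  | succ d => simp [add_mul, mul_assoc, PowerSeries.coeff_succ_X_mul, PowerSeries.coeff_one,
      pow_succ, mul_comm a]

theorem sum_antidiagonal_esymm_mul_signedHsymm (s t : Multiset A) (d : ℕ) :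
    ∑ a ∈ antidiagonal d, (s + t).esymm a.1 * signedHsymm s a.2 = t.esymm d := by
  simp only [← coeff_prod_one_add_C_mul_X, signedHsymm]
  rw [← PowerSeries.coeff_mul, Multiset.map_add, Multiset.prod_add, mul_right_comm,
    ← Multiset.prod_map_mul]
  simp only [one_add_C_mul_X_mul_geom, Multiset.map_const', Multiset.prod_replicate, one_pow,
    one_mul]

theorem esymm_eq_zero_of_card_lt {s : Multiset A} {d : ℕ} (h : s.card < d) : s.esymm d = 0 := by
  rw [Multiset.esymm, Multiset.powersetCard_eq_empty d h, Multiset.map_zero, Multiset.sum_zero]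

theorem sum_range_esymm_mul_mem (I : Ideal A) {s t : Multiset A} {m d : ℕ}
    (hI : ∀ e, m ≤ e → (s + t).esymm e ∈ I) (hd : t.card < d) :
    ∑ j ∈ Finset.range m, (s + t).esymm j * (if j ≤ d then signedHsymm s (d - j) else 0) ∈ I := by
  -- The full alternating sum over `j ≤ d` is `e_d(t) = 0`, so the truncated one is minus a tail
  -- whose terms lie in `I`.
  set F : ℕ → A := fun j => (s + t).esymm j * (if j ≤ d then signedHsymm s (d - j) else 0) with hF
  have htotal : ∑ j ∈ Finset.range (d + 1), F j = 0 := by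
    rw [← esymm_eq_zero_of_card_lt hd, ← sum_antidiagonal_esymm_mul_signedHsymm s t,
      Finset.Nat.sum_antidiagonal_eq_sum_range_succ fun a b => (s + t).esymm a * signedHsymm s b]
    refine Finset.sum_congr rfl fun j hj => ?_
    simp only [hF, if_pos (Finset.mem_range_succ_iff.1 hj)]
  have hsplit : ∑ j ∈ Finset.range m, F j + ∑ j ∈ Finset.range (d + 1), F (m + j) =
      ∑ j ∈ Finset.range (d + 1), F j + ∑ j ∈ Finset.range m, F (d + 1 + j) := by
    rw [← Finset.sum_range_add, ← Finset.sum_range_add, add_comm m]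
  have hbeyond : ∑ j ∈ Finset.range m, F (d + 1 + j) = 0 :=
    Finset.sum_eq_zero fun j _ => by
      simp only [hF, if_neg (show ¬d + 1 + j ≤ d by omega), mul_zero]
  rw [htotal, hbeyond, add_zero] at hsplit
  rw [eq_neg_of_add_eq_zero_left hsplit]
  exact I.neg_mem (I.sum_mem fun j _ => I.mul_mem_right _ (hI _ (Nat.le_add_right m j)))

end SymmetricFunctions

section SymmetricPolynomials

variable {σ R : Type*} [CommRing R]

/-- The elementary symmetric polynomial of degree `d` in the variables indexed by `U`. -/
noncomputable def esymmOn (U : Finset σ) (d : ℕ) : MvPolynomial σ R :=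
  (U.val.map X).esymm d

theorem esymmOn_eq_sum (U : Finset σ) (d : ℕ) :
    (esymmOn U d : MvPolynomial σ R) = ∑ s ∈ U.powersetCard d, ∏ j ∈ s, X j :=
  Finset.esymm_map_val X U d

theorem esymmOn_zero (U : Finset σ) : (esymmOn U 0 : MvPolynomial σ R) = 1 := by
  simp [esymmOn_eq_sum]

theorem esymmOn_eq_zero_of_card_lt {U : Finset σ} {d : ℕ} (h : U.card < d) :
    (esymmOn U d : MvPolynomial σ R) = 0 :=
  esymm_eq_zero_of_card_lt (by simpa using h)

theorem signedHsymm_map_X [DecidableEq σ] (P : Finset σ) (d : ℕ) :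
    signedHsymm (P.val.map (X : σ → MvPolynomial σ R)) d =
      ∑ l ∈ P.finsuppAntidiag d, monomial l ((-1) ^ d) := by
  have h : ((P.val.map X).map fun a : MvPolynomial σ R =>
      PowerSeries.mk fun b => (-a) ^ b).prod = ∏ i ∈ P, PowerSeries.mk fun b => (-X i) ^ b := by
    rw [Multiset.map_map]; rfl
  rw [signedHsymm, h, PowerSeries.coeff_prod]
  refine Finset.sum_congr rfl fun l hl => ?_
  obtain ⟨hsum, hsupp⟩ := Finset.mem_finsuppAntidiag.1 hl
  simp only [PowerSeries.coeff_mk, neg_pow (X _ : MvPolynomial σ R)]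
  rw [Finset.prod_mul_distrib, Finset.prod_pow_eq_pow_sum, hsum, monomial_eq,
    Finsupp.prod_of_support_subset l hsupp _ fun _ _ => pow_zero _, map_pow, map_neg, map_one]

end SymmetricPolynomials

/-! ### Skip monomials are leading monomials -/

section MonomialOrder

variable {σ R : Type*} [CommRing R] {m : MonomialOrder σ}

theorem degree_eq_of_coeff_ne_zero {f : MvPolynomial σ R} {D : σ →₀ ℕ}
    (h : m.toSyn (m.degree f) ≤ m.toSyn D) (hD : coeff D f ≠ 0) : m.degree f = D :=
  m.toSyn.injective (le_antisymm h (m.le_degree (mem_support_iff.2 hD)))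

theorem degree_sign_smul (u : ℤˣ) (f : MvPolynomial σ R) : m.degree (u • f) = m.degree f := by
  rcases Int.units_eq_one_or u with rfl | rfl <;> simp

variable {ι : Type*} [Fintype ι] {M : Matrix ι ι (MvPolynomial σ R)}

theorem degree_prod_perm_le {E : ι → ι → σ →₀ ℕ}
    (hM : ∀ j p, m.toSyn (m.degree (M j p)) ≤ m.toSyn (E j p)) (π : Equiv.Perm ι) :
    m.toSyn (m.degree (∏ p, M (π p) p)) ≤ m.toSyn (∑ p, E (π p) p) := by
  refine m.degree_prod_le.trans ?_
  rw [map_sum, map_sum]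
  exact Finset.sum_le_sum fun p _ => hM (π p) p

theorem det_ne_zero_and_degree_det [DecidableEq ι] [IsDomain R] {E : ι → ι → σ →₀ ℕ}
    (hM : ∀ j p, m.toSyn (m.degree (M j p)) ≤ m.toSyn (E j p))
    (hdiag : ∀ p, coeff (E p p) (M p p) ≠ 0)
    (hE : ∀ π : Equiv.Perm ι, π ≠ 1 → m.toSyn (∑ p, E (π p) p) < m.toSyn (∑ p, E p p)) :
    M.det ≠ 0 ∧ m.degree M.det = ∑ p, E p p := by
  have hcoeff_one : coeff (∑ p, E p p) (∏ p, M p p) ≠ 0 := by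
    have hdeg : ∀ p, m.degree (M p p) = E p p := fun p =>
      degree_eq_of_coeff_ne_zero (hM p p) (hdiag p)
    simp only [← hdeg, m.coeff_prod_sum_degree]
    exact Finset.prod_ne_zero_iff.2 fun p _ => by
      rw [MonomialOrder.leadingCoeff, hdeg]; exact hdiag p
  have hcoeff : coeff (∑ p, E p p) M.det ≠ 0 := by
    rw [Matrix.det_apply, coeff_sum, Finset.sum_eq_single_of_mem 1 (Finset.mem_univ _)]
    · simpa using hcoeff_one
    · intro π _ hπ
      refine m.coeff_eq_zero_of_lt ?_
      rw [degree_sign_smul]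
      exact (degree_prod_perm_le hM π).trans_lt (hE π hπ)
  refine ⟨fun h => hcoeff (by rw [h, coeff_zero]), degree_eq_of_coeff_ne_zero ?_ hcoeff⟩
  rw [Matrix.det_apply]
  refine m.degree_sum_le.trans (Finset.sup_le fun π _ => ?_)
  rw [degree_sign_smul]
  refine (degree_prod_perm_le hM π).trans ?_
  obtain rfl | hπ := eq_or_ne π 1
  · exact le_rfl
  · exact (hE π hπ).le

end MonomialOrder

theorem det_mul_mem_of_vecMul_mem {ι A : Type*} [Fintype ι] [DecidableEq ι] [CommRing A]
    (I : Ideal A) {M : Matrix ι ι A} {v : ι → A} (h : ∀ p, Matrix.vecMul v M p ∈ I) (j : ι) :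
    M.det * v j ∈ I := by
  have hadj : Matrix.vecMul (Matrix.vecMul v M) M.adjugate j = M.det * v j := by
    rw [Matrix.vecMul_vecMul, Matrix.mul_adjugate, Matrix.vecMul_smul, Matrix.vecMul_one,
      Pi.smul_apply, smul_eq_mul]
  rw [← hadj]
  exact I.sum_mem fun p _ => I.mul_mem_right _ (h p)

section NumAbove

variable {ι : Type*} [LinearOrder ι]

/-- The number of elements of `A` above `i`. -/
def numAbove (A : Finset ι) (i : ι) : ℕ :=
  (A.filter (i < ·)).card

theorem numAbove_mono {A B : Finset ι} (h : A ⊆ B) (i : ι) : numAbove A i ≤ numAbove B i :=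
  Finset.card_le_card (Finset.filter_subset_filter _ h)

theorem numAbove_insert_of_le {a i : ι} (h : a ≤ i) (A : Finset ι) :
    numAbove (insert a A) i = numAbove A i := by
  rw [numAbove, Finset.filter_insert, if_neg h.not_gt, numAbove]

theorem numAbove_lt_numAbove {A : Finset ι} {i j : ι} (hj : j ∈ A) (h : i < j) :
    numAbove A j < numAbove A i := by
  refine Finset.card_lt_card ((Finset.ssubset_iff_of_subset ?_).2 ⟨j, by simp [hj, h], by simp⟩)
  exact Finset.monotone_filter_right A fun _ _ => h.trans

theorem injOn_numAbove (A : Finset ι) : Set.InjOn (numAbove A) A :=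
  StrictAntiOn.injOn fun _ _ _ hj h => numAbove_lt_numAbove hj h

theorem numAbove_lt_card {A : Finset ι} {i : ι} (hi : i ∈ A) : numAbove A i < A.card :=
  Finset.card_lt_card (Finset.filter_ssubset.2 ⟨i, hi, lt_irrefl i⟩)

theorem image_numAbove (A : Finset ι) : A.image (numAbove A) = Finset.range A.card := by
  refine Finset.eq_of_subset_of_card_le (Finset.image_subset_iff.2 fun i hi =>
    Finset.mem_range.2 (numAbove_lt_card hi)) ?_
  rw [Finset.card_image_of_injOn (injOn_numAbove A), Finset.card_range]

theorem exists_numAbove_eq {A : Finset ι} {v : ℕ} (hv : v < A.card) : ∃ i ∈ A, numAbove A i = v :=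
  Finset.mem_image.1 ((image_numAbove A).symm ▸ Finset.mem_range.2 hv)

theorem sum_numAbove {N : Type*} [AddCommMonoid N] (A : Finset ι) (f : ℕ → N) :
    ∑ i : A, f (numAbove A i) = ∑ v ∈ Finset.range A.card, f v := by
  rw [← image_numAbove, Finset.sum_image (injOn_numAbove A),
    Finset.sum_coe_sort A fun i => f (numAbove A i)]

theorem numAbove_sdiff_add_numAbove {T U : Finset ι} (hT : T ⊆ U) (i : ι) :
    numAbove (U \ T) i + numAbove T i = numAbove U i := by
  rw [numAbove, numAbove, ← Finset.card_union_of_disjoint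
    (Finset.disjoint_filter_filter Finset.sdiff_disjoint), ← Finset.filter_union,
    Finset.sdiff_union_of_subset hT, numAbove]

theorem exists_apply_lt_of_ne_one [Finite ι] {π : Equiv.Perm ι} (h : π ≠ 1) :
    ∃ p, π p < p ∧ ∀ q, p < q → π q = q := by
  obtain ⟨q, hq⟩ : {p | π p ≠ p}.Nonempty := by
    by_contra! hempty
    exact h (Equiv.ext fun p => by_contra fun hp => Set.notMem_empty p (hempty ▸ hp))
  obtain ⟨p, hp, hmax⟩ := wellFounded_gt.has_min {p | π p ≠ p} ⟨q, hq⟩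
  have hfix : ∀ q, p < q → π q = q := fun q hpq => by_contra fun hq => hmax q hq hpq
  exact ⟨p, lt_of_le_of_ne (not_lt.1 fun hlt => hp (π.injective (hfix _ hlt))) hp, hfix⟩

end NumAbove

section SkipMatrix

variable {n : ℕ}

theorem toSyn_le_toSyn_single {l : Fin n →₀ ℕ} {p : Fin n} {d : ℕ} (hd : l.degree = d)
    (hp : ∀ i, p < i → l i = 0) :
    (lexOrder n).toSyn l ≤ (lexOrder n).toSyn (Finsupp.single p d) := by
  have hsplit := congrArg Finsupp.degree (Finsupp.single_add_erase p l)
  rw [map_add, Finsupp.degree_single, hd] at hsplit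
  rcases (Nat.le.intro hsplit).lt_or_eq with hlt | heq
  · refine le_of_lt (lexOrder_lt_iff.2 ⟨p, fun i hi => ?_, by simpa using hlt⟩)
    rw [hp i hi, Finsupp.single_eq_of_ne hi.ne']
  · have herase : l.erase p = 0 := (Finsupp.degree_eq_zero_iff _).1 (by omega)
    rw [← Finsupp.single_add_erase p l, heq, herase, add_zero]

theorem sum_single_lt_sum_single {T : Finset (Fin n)} {f g : T → ℕ} (p : T)
    (habove : ∀ q, p < q → f q = g q) (hp : f p < g p) :
    (lexOrder n).toSyn (∑ q : T, Finsupp.single (q : Fin n) (f q)) <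
      (lexOrder n).toSyn (∑ q : T, Finsupp.single (q : Fin n) (g q)) := by
  refine lexOrder_lt_iff.2 ⟨p, fun i hi => ?_, ?_⟩ <;>
    simp only [Finsupp.finsetSum_apply, Finsupp.single_apply]
  · refine Finset.sum_congr rfl fun q _ => ?_
    split_ifs with hq
    · exact habove q (Subtype.coe_lt_coe.1 (hq ▸ hi))
    · rfl
  · refine Finset.sum_lt_sum (fun q _ => ?_) ⟨p, Finset.mem_univ p, by simpa using hp⟩
    split_ifs with hq
    · exact (Subtype.ext hq : q = p) ▸ hp.le
    · exact le_rfl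

variable {R : Type*} [CommRing R]

theorem degree_signedHsymm_le {P : Finset (Fin n)} {p : Fin n} (hP : ∀ i ∈ P, i ≤ p) (d : ℕ) :
    (lexOrder n).toSyn ((lexOrder n).degree (signedHsymm (P.val.map (X (R := R))) d)) ≤
      (lexOrder n).toSyn (Finsupp.single p d) := by
  rw [signedHsymm_map_X, MonomialOrder.degree_le_iff]
  intro l hl
  obtain ⟨l', hl', hmem⟩ := Finset.mem_biUnion.1 (support_sum hl)
  obtain rfl := Finset.mem_singleton.1 (support_monomial_subset hmem)
  obtain ⟨hdeg, hsupp⟩ := Finset.mem_finsuppAntidiag'.1 hl'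
  refine toSyn_le_toSyn_single hdeg fun i hi => ?_
  exact Finsupp.notMem_support_iff.1 fun hmem => (hP i (hsupp hmem)).not_gt hi

theorem coeff_single_signedHsymm {P : Finset (Fin n)} {p : Fin n} (hp : p ∈ P) (d : ℕ) :
    coeff (Finsupp.single p d) (signedHsymm (P.val.map (X (R := R))) d) = (-1) ^ d := by
  rw [signedHsymm_map_X, coeff_sum, Finset.sum_eq_single_of_mem (Finsupp.single p d)]
  · rw [coeff_monomial, if_pos rfl]
  · rw [Finset.mem_finsuppAntidiag']
    exact ⟨Finsupp.sum_single_index rfl,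
      Finsupp.support_single_subset.trans (Finset.singleton_subset_iff.2 hp)⟩
  · exact fun l _ hl => by rw [coeff_monomial, if_neg hl]

/-- The matrix over the variables in `T` (a flagged Jacobi–Trudi matrix) whose determinant has as
its leading monomial the skip monomial of `T` in `U`. -/
noncomputable def skipMatrix (R : Type*) [CommRing R] (U T : Finset (Fin n)) :
    Matrix T T (MvPolynomial (Fin n) R) := fun j p =>
  if numAbove T j ≤ numAbove U p + 1 then
    signedHsymm ((U.filter (· ≤ (p : Fin n))).val.map X) (numAbove U p + 1 - numAbove T j) else 0

theorem degree_skipMatrix_le (U T : Finset (Fin n)) (j p : T) :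
    (lexOrder n).toSyn ((lexOrder n).degree (skipMatrix R U T j p)) ≤
      (lexOrder n).toSyn (Finsupp.single (p : Fin n) (numAbove U p + 1 - numAbove T j)) := by
  rw [skipMatrix]
  split_ifs
  · exact degree_signedHsymm_le (fun i hi => (Finset.mem_filter.1 hi).2) _
  · rw [MonomialOrder.degree_zero, map_zero]
    exact bot_le

theorem det_skipMatrix_ne_zero_and_degree [IsDomain R] {U T : Finset (Fin n)} (hT : T ⊆ U) :
    (skipMatrix R U T).det ≠ 0 ∧ (lexOrder n).degree (skipMatrix R U T).det =
      ∑ p : T, Finsupp.single (p : Fin n) (numAbove (U \ T) p + 1) := by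
  have hle : ∀ i, numAbove T i ≤ numAbove U i := numAbove_mono hT
  have hexp : ∀ i, numAbove (U \ T) i + 1 = numAbove U i + 1 - numAbove T i := fun i => by
    have := numAbove_sdiff_add_numAbove hT i
    omega
  simp only [hexp]
  refine det_ne_zero_and_degree_det (degree_skipMatrix_le U T) (fun p => ?_) fun π hπ => ?_
  · rw [skipMatrix, if_pos ((hle p).trans (Nat.le_succ _)), coeff_single_signedHsymm]
    · exact pow_ne_zero _ (neg_ne_zero.2 one_ne_zero)
    · exact Finset.mem_filter.2 ⟨hT p.2, le_rfl⟩
  · -- At the largest non-fixed point `p`, `π` selects a smaller exponent than the diagonal does.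
    obtain ⟨p, hp, hfix⟩ := exists_apply_lt_of_ne_one hπ
    refine sum_single_lt_sum_single p (fun q hq => by rw [hfix q hq]) ?_
    have := numAbove_lt_numAbove p.2 hp
    have := hle p
    omega

theorem vecMul_skipMatrix_mem {U T : Finset (Fin n)} {I : Ideal (MvPolynomial (Fin n) R)}
    (hI : ∀ d, T.card ≤ d → esymmOn U d ∈ I) (p : T) :
    Matrix.vecMul (fun j : T => esymmOn U (numAbove T j)) (skipMatrix R U T) p ∈ I := by
  have hU : ((U.filter (· ≤ (p : Fin n))).val.map X + (U.filter ((p : Fin n) < ·)).val.map X :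
      Multiset (MvPolynomial (Fin n) R)) = U.val.map X := by
    simp only [← not_le]
    rw [← Multiset.map_add, Finset.filter_val, Finset.filter_val, Multiset.filter_add_not]
  have h := sum_range_esymm_mul_mem I (s := (U.filter (· ≤ (p : Fin n))).val.map X)
    (t := (U.filter ((p : Fin n) < ·)).val.map X) (m := T.card) (d := numAbove U p + 1)
    (by rwa [hU]) (by rw [Multiset.card_map]; exact Nat.lt_succ_self _)
  rw [hU, ← sum_numAbove] at h
  exact h

theorem det_skipMatrix_mem {U T : Finset (Fin n)} {I : Ideal (MvPolynomial (Fin n) R)}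
    (hI : ∀ d, T.card ≤ d → esymmOn U d ∈ I) : (skipMatrix R U T).det ∈ I := by
  obtain hT | hT := T.card.eq_zero_or_pos
  · rw [(Ideal.eq_top_iff_one I).2 (esymmOn_zero (R := R) U ▸ hI 0 hT.le)]
    exact Submodule.mem_top
  · obtain ⟨j, hj, hj0⟩ := exists_numAbove_eq hT
    have h := det_mul_mem_of_vecMul_mem I (vecMul_skipMatrix_mem hI) ⟨j, hj⟩
    rwa [hj0, esymmOn_zero, mul_one] at h

theorem exists_degree_eq_skip [IsDomain R] {U T : Finset (Fin n)} (hT : T ⊆ U)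
    {I : Ideal (MvPolynomial (Fin n) R)} (hI : ∀ d, T.card ≤ d → esymmOn U d ∈ I) :
    ∃ f ∈ I, f ≠ 0 ∧ (lexOrder n).degree f =
      ∑ i ∈ T, Finsupp.single i (numAbove (U \ T) i + 1) := by
  obtain ⟨hne, hdeg⟩ := det_skipMatrix_ne_zero_and_degree (R := R) hT
  refine ⟨_, det_skipMatrix_mem hI, hne, hdeg.trans ?_⟩
  exact Finset.sum_coe_sort T fun i => Finsupp.single i (numAbove (U \ T) i + 1)

end SkipMatrix

/-! ### Standard monomials form a basis -/

section StandardBasis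

variable {n : ℕ} (m : MonomialOrder (Fin n)) (I : Ideal (MvPolynomial (Fin n) ℚ))

theorem monomial_mem_leadingMonomialIdeal_iff {c : Fin n →₀ ℕ} :
    monomial c 1 ∈ leadingMonomialIdeal m I ↔ ∃ f ∈ I, f ≠ 0 ∧ m.degree f ≤ c := by
  have himage : {p : MvPolynomial (Fin n) ℚ | ∃ f ∈ I, f ≠ 0 ∧ p = monomial (m.degree f) 1} =
      (fun c => monomial c (1 : ℚ)) '' (m.degree '' {f | f ∈ I ∧ f ≠ 0}) := by
    ext p
    constructor
    · rintro ⟨f, hf, hf0, rfl⟩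
      exact ⟨_, ⟨f, ⟨hf, hf0⟩, rfl⟩, rfl⟩
    · rintro ⟨_, ⟨f, ⟨hf, hf0⟩, rfl⟩, rfl⟩
      exact ⟨f, hf, hf0, rfl⟩
  simp [leadingMonomialIdeal, himage, mem_ideal_span_monomial_image, support_monomial, and_assoc]

theorem exists_mem_span_standardMonomials_sub_mem (p : MvPolynomial (Fin n) ℚ) :
    ∃ r ∈ Submodule.span ℚ (standardMonomials m I), p - r ∈ I := by
  obtain ⟨g, r, hp, -, hr⟩ := m.div_set (B := {f | f ∈ I ∧ f ≠ 0})
    (fun f hf => isUnit_iff_ne_zero.2 (m.leadingCoeff_ne_zero_iff.2 hf.2)) p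
  refine ⟨r, ?_, ?_⟩
  · rw [r.as_sum]
    refine Submodule.sum_mem _ fun c hc => ?_
    rw [← mul_one (coeff c r), ← smul_eq_mul, ← smul_monomial]
    refine Submodule.smul_mem _ _ (Submodule.subset_span ⟨⟨c, rfl⟩, fun hmem => ?_⟩)
    obtain ⟨f, hf, hf0, hle⟩ := (monomial_mem_leadingMonomialIdeal_iff m I).1 hmem
    exact hr c hc f ⟨hf, hf0⟩ hle
  · rw [hp, add_sub_cancel_right, Finsupp.linearCombination_apply]
    exact I.sum_mem fun f _ => I.mul_mem_left _ f.2.1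

theorem eq_zero_of_mem_span_standardMonomials {r : MvPolynomial (Fin n) ℚ}
    (hr : r ∈ Submodule.span ℚ (standardMonomials m I)) (hI : r ∈ I) : r = 0 := by
  have hle : Submodule.span ℚ (standardMonomials m I) ≤
      restrictSupport ℚ {c | monomial c (1 : ℚ) ∉ leadingMonomialIdeal m I} := by
    refine Submodule.span_le.2 ?_
    rintro _ ⟨⟨c, rfl⟩, hc⟩ d hd
    rwa [Finset.mem_singleton.1 (support_monomial_subset hd)]
  by_contra hr0
  exact hle hr (m.degree_mem_support hr0)
    ((monomial_mem_leadingMonomialIdeal_iff m I).2 ⟨r, hI, hr0, le_rfl⟩)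

theorem linearIndepOn_standardMonomials :
    LinearIndepOn ℚ id (standardMonomials m I) := by
  refine (basisMonomials (Fin n) ℚ).linearIndependent.linearIndepOn_id.mono ?_
  rintro _ ⟨⟨c, rfl⟩, -⟩
  exact ⟨c, congrFun (coe_basisMonomials (Fin n) ℚ) c⟩

theorem exists_basis_standardMonomials :
    ∃ b : Module.Basis (standardMonomials m I) ℚ (MvPolynomial (Fin n) ℚ ⧸ I),
      ∀ p, b p = Ideal.Quotient.mk I (p : MvPolynomial (Fin n) ℚ) := by
  set mkI : MvPolynomial (Fin n) ℚ →ₗ[ℚ] MvPolynomial (Fin n) ℚ ⧸ I :=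
    (Ideal.Quotient.mkₐ ℚ I).toLinearMap
  have hdisjoint : Disjoint (Submodule.span ℚ (Set.range
      fun p : standardMonomials m I => (p : MvPolynomial (Fin n) ℚ))) (LinearMap.ker mkI) := by
    rw [Subtype.range_coe, Submodule.disjoint_def]
    exact fun r hr hI => eq_zero_of_mem_span_standardMonomials m I hr
      (Ideal.Quotient.eq_zero_iff_mem.1 hI)
  refine ⟨Module.Basis.mk ((linearIndepOn_standardMonomials m I).map hdisjoint) ?_,
    fun p => by rw [Module.Basis.mk_apply]; rfl⟩
  rintro x -
  obtain ⟨p, rfl⟩ := Ideal.Quotient.mk_surjective x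
  obtain ⟨r, hr, hpr⟩ := exists_mem_span_standardMonomials_sub_mem m I p
  rw [Set.range_comp]
  simp only [id_eq, Subtype.range_coe]
  rw [← Submodule.map_span]
  exact ⟨r, hr, (Ideal.Quotient.eq.2 hpr).symm⟩

end StandardBasis

/-! ### Orbit harmonics -/

section TopForms

variable {σ R : Type*} [CommRing R]

/-- `g` is the degree `e` part of `q`, and `q` has no terms of degree greater than `e`. The form
`g` is allowed to be zero. -/
def IsTopForm (e : ℕ) (q g : MvPolynomial σ R) : Prop :=
  g.IsHomogeneous e ∧ ∀ c, e ≤ c.degree → coeff c q = coeff c g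

namespace IsTopForm

variable {e e' : ℕ} {q q' g g' : MvPolynomial σ R}

theorem coeff_eq_zero (h : IsTopForm e q g) {c : σ →₀ ℕ} (hc : e < c.degree) : coeff c q = 0 :=
  (h.2 c hc.le).trans (h.1.coeff_eq_zero hc.ne')

theorem of_isHomogeneous (h : g.IsHomogeneous e) : IsTopForm e g g :=
  ⟨h, fun _ _ => rfl⟩

theorem add (h : IsTopForm e q g) (h' : IsTopForm e q' g') :
    IsTopForm e (q + q') (g + g') :=
  ⟨h.1.add h'.1, fun c hc => by rw [coeff_add, coeff_add, h.2 c hc, h'.2 c hc]⟩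

theorem mul (h : IsTopForm e q g) (h' : IsTopForm e' q' g') :
    IsTopForm (e + e') (q * q') (g * g') := by
  classical
  refine ⟨h.1.mul h'.1, fun c hc => ?_⟩
  rw [coeff_mul, coeff_mul]
  refine Finset.sum_congr rfl fun a ha => ?_
  have hdegree : a.1.degree + a.2.degree = c.degree := by
    rw [← Finset.HasAntidiagonal.mem_antidiagonal.1 ha, map_add]
  rcases lt_trichotomy a.1.degree e with hlt | heq | hgt
  · have hlt' : e' < a.2.degree := by omega
    rw [h'.coeff_eq_zero hlt', h'.1.coeff_eq_zero hlt'.ne', mul_zero, mul_zero]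
  · rw [h.2 _ heq.ge, h'.2 _ (by omega)]
  · rw [h.coeff_eq_zero hgt, h.1.coeff_eq_zero hgt.ne', zero_mul, zero_mul]

theorem prod_X_sub_C (i : σ) (d : ℕ) (a : ℕ → R) :
    IsTopForm d (∏ m ∈ Finset.range d, (X i - C (a m))) (X i ^ d) := by
  classical
  induction d with
  | zero => simpa using of_isHomogeneous (isHomogeneous_one σ R)
  | succ d ih =>
    rw [Finset.prod_range_succ, pow_succ]
    refine ih.mul ⟨isHomogeneous_X R i, fun c hc => ?_⟩
    have hc0 : (0 : σ →₀ ℕ) ≠ c := by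
      rintro rfl
      simp at hc
    rw [coeff_sub, coeff_C, if_neg hc0, sub_zero]

end IsTopForm

/-- The associated graded ideal of `J`, generated by the top forms of the elements of `J`. -/
noncomputable def topFormIdeal (J : Ideal (MvPolynomial σ R)) : Ideal (MvPolynomial σ R) :=
  Ideal.span {g | ∃ e, ∃ q ∈ J, IsTopForm e q g}

variable {J : Ideal (MvPolynomial σ R)}

theorem exists_isTopForm_homogeneousComponent {e : ℕ} {q g : MvPolynomial σ R} (hq : q ∈ J)
    (h : IsTopForm e q g) (D : ℕ) : ∃ q' ∈ J, IsTopForm D q' (homogeneousComponent D g) := by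
  rw [homogeneousComponent_of_mem h.1]
  split_ifs with hD
  · exact ⟨q, hq, hD ▸ h⟩
  · exact ⟨0, J.zero_mem, .of_isHomogeneous (isHomogeneous_zero σ R D)⟩

theorem exists_isTopForm_of_mem_topFormIdeal {p : MvPolynomial σ R} (hp : p ∈ topFormIdeal J)
    (D : ℕ) : ∃ q ∈ J, IsTopForm D q (homogeneousComponent D p) := by
  induction hp using Submodule.closure_induction with
  | zero => exact ⟨0, J.zero_mem, by simpa using .of_isHomogeneous (isHomogeneous_zero σ R D)⟩
  | add x y _ _ hx hy =>
    obtain ⟨q, hq, hqx⟩ := hx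
    obtain ⟨q', hq', hqy⟩ := hy
    exact ⟨q + q', J.add_mem hq hq', by simpa using hqx.add hqy⟩
  | smul_mem r g hg =>
    obtain ⟨e, q, hq, hqg⟩ := hg
    have hcomponent : ∀ d, ∃ q' ∈ J,
        IsTopForm D q' (homogeneousComponent D (homogeneousComponent d r * g)) := fun d =>
      exists_isTopForm_homogeneousComponent (J.mul_mem_left _ hq)
        ((IsTopForm.of_isHomogeneous (homogeneousComponent_isHomogeneous d r)).mul hqg) D
    rw [smul_eq_mul, ← sum_homogeneousComponent r, Finset.sum_mul, map_sum]
    refine Finset.sum_induction _ (fun f => ∃ q' ∈ J, IsTopForm D q' f) ?_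
      ⟨0, J.zero_mem, .of_isHomogeneous (isHomogeneous_zero σ R D)⟩ fun d _ => hcomponent d
    rintro f f' ⟨q, hq, hqf⟩ ⟨q', hq', hqf'⟩
    exact ⟨q + q', J.add_mem hq hq', hqf.add hqf'⟩

theorem exists_sub_mem_of_exists_sub_mem_topFormIdeal {W : Submodule R (MvPolynomial σ R)}
    (hW : ∀ D, ∀ r ∈ W, homogeneousComponent D r ∈ W)
    (hspan : ∀ p, ∃ r ∈ W, p - r ∈ topFormIdeal J) (p : MvPolynomial σ R) :
    ∃ r ∈ W, p - r ∈ J := by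
  suffices h : ∀ (D : ℕ) (p : MvPolynomial σ R), (∀ c, D ≤ c.degree → coeff c p = 0) →
      ∃ r ∈ W, p - r ∈ J from
    h (p.totalDegree + 1) p fun c hc => coeff_eq_zero_of_totalDegree_lt hc
  intro D
  induction D with
  | zero =>
    intro p hp
    obtain rfl : p = 0 := MvPolynomial.ext p 0 fun c => by simpa using hp c (Nat.zero_le _)
    exact ⟨0, W.zero_mem, by simp⟩
  | succ D ih =>
    intro p hp
    obtain ⟨r, hr, hpr⟩ := hspan p
    obtain ⟨q, hq, hqtop⟩ := exists_isTopForm_of_mem_topFormIdeal hpr D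
    have hlower : ∀ c : σ →₀ ℕ, D ≤ c.degree →
        coeff c (p - homogeneousComponent D r - q) = 0 := fun c hc => by
      rw [coeff_sub, coeff_sub, hqtop.2 c hc, coeff_homogeneousComponent,
        coeff_homogeneousComponent, coeff_sub]
      split_ifs with hcD
      · exact sub_self _
      · rw [hp c (by omega), sub_zero, sub_zero]
    obtain ⟨r', hr', hpr'⟩ := ih _ hlower
    refine ⟨homogeneousComponent D r + r', W.add_mem (hW D r hr) hr', ?_⟩
    convert J.add_mem hpr' hq using 1
    ring

theorem homogeneousComponent_mem_span_of_subset_range_monomial {S : Set (MvPolynomial σ R)}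
    (hS : ∀ s ∈ S, ∃ c, s = monomial c 1) (D : ℕ) {r : MvPolynomial σ R}
    (hr : r ∈ Submodule.span R S) : homogeneousComponent D r ∈ Submodule.span R S := by
  suffices h : Submodule.span R S ≤ (Submodule.span R S).comap (homogeneousComponent D) from h hr
  refine Submodule.span_le.2 fun s hs => ?_
  obtain ⟨c, rfl⟩ := hS s hs
  rw [SetLike.mem_coe, Submodule.mem_comap,
    homogeneousComponent_of_mem (isHomogeneous_monomial (1 : R) (Eq.refl c.degree))]
  split_ifs
  · exact Submodule.subset_span hs
  · exact Submodule.zero_mem _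

end TopForms

theorem ncard_le_ncard_of_sub_mem_vanishingIdeal {σ K : Type*} [Field K] {Y : Set (σ → K)}
    {S : Set (MvPolynomial σ K)} (hY : Y.Finite) (hS : S.Finite)
    (hspan : ∀ p, ∃ r ∈ Submodule.span K S, p - r ∈ vanishingIdeal K Y) :
    Y.ncard ≤ S.ncard := by
  have := hY.fintype
  have := hS.fintype
  set evalAt : Y → MvPolynomial σ K →ₗ[K] K := fun y => (aeval (y : σ → K)).toLinearMap
  have hindependent : LinearIndependent K evalAt := by
    refine (linearIndependent_algHom_toLinearMap K (MvPolynomial σ K) K).comp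
      (fun y : Y => (aeval (y : σ → K) : MvPolynomial σ K →ₐ[K] K)) fun y z hyz => ?_
    refine Subtype.ext (funext fun i => ?_)
    simpa using DFunLike.congr_fun hyz (X i)
  set combination := Fintype.linearCombination K evalAt
  set pairing : (Y → K) →ₗ[K] (S → K) :=
    LinearMap.pi fun s => LinearMap.applyₗ (s : MvPolynomial σ K) ∘ₗ combination
  have hpairing : Function.Injective pairing := by
    refine (injective_iff_map_eq_zero pairing).2 fun w hw => ?_
    refine (injective_iff_map_eq_zero combination).1
      hindependent.fintypeLinearCombination_injective w (LinearMap.ext fun p => ?_)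
    have hspanS : Submodule.span K S ≤ LinearMap.ker (combination w) :=
      Submodule.span_le.2 fun s hs => congrFun hw ⟨s, hs⟩
    obtain ⟨r, hr, hpr⟩ := hspan p
    have hvanish : combination w (p - r) = 0 := by
      rw [Fintype.linearCombination_apply, LinearMap.sum_apply]
      refine Finset.sum_eq_zero fun y _ => ?_
      rw [LinearMap.smul_apply, show evalAt y (p - r) = 0 from hpr y y.2, smul_zero]
    rw [← sub_add_cancel p r, map_add, hvanish, hspanS hr, add_zero, LinearMap.zero_apply]
  rw [Set.ncard_eq_toFinset_card', Set.ncard_eq_toFinset_card', Set.toFinset_card,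
    Set.toFinset_card]
  exact card_le_of_injective K pairing hpairing

/-! ### Perturbed elementary symmetric polynomials -/

section PerturbedEsymm

variable {σ R : Type*} [CommRing R] (U : Finset σ) (s : Multiset R) (N : ℕ)

/-- The coefficient of `T ^ N` in the power series `∏ j ∈ U, (1 + x_j T) / ∏ a ∈ s, (1 + a T)`.
It deforms the elementary symmetric polynomial of degree `N` into one vanishing at the points whose
coordinates take all values in `s`. -/
noncomputable def perturbedEsymm : MvPolynomial σ R :=
  ∑ a ∈ antidiagonal N, esymmOn U a.1 * C (signedHsymm s a.2)

theorem signedHsymm_zero : signedHsymm s 0 = 1 := by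
  simpa [Multiset.esymm] using sum_antidiagonal_esymm_mul_signedHsymm s 0 0

theorem isHomogeneous_esymmOn : (esymmOn U N : MvPolynomial σ R).IsHomogeneous N := by
  rw [esymmOn_eq_sum]
  refine IsHomogeneous.sum _ _ _ fun s hs => ?_
  simpa [(Finset.mem_powersetCard.1 hs).2] using
    IsHomogeneous.prod s (X : σ → MvPolynomial σ R) (fun _ => 1) fun j _ => isHomogeneous_X R j

theorem isTopForm_perturbedEsymm : IsTopForm N (perturbedEsymm U s N) (esymmOn U N) := by
  refine ⟨isHomogeneous_esymmOn U N, fun c hc => ?_⟩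
  rw [perturbedEsymm, coeff_sum, Finset.sum_eq_single_of_mem (N, 0) (by simp)]
  · rw [signedHsymm_zero, C_1, mul_one]
  · rintro ⟨a, b⟩ hab hne
    have hab : a + b = N := Finset.HasAntidiagonal.mem_antidiagonal.1 hab
    have haN : a ≠ N := by
      rintro rfl
      exact hne (by simpa using hab)
    rw [mul_comm, coeff_C_mul, (isHomogeneous_esymmOn U a).coeff_eq_zero (by omega), mul_zero]

variable {U s N} {y : σ → R}

theorem eval_esymmOn : eval y (esymmOn U N) = (U.val.map y).esymm N := by
  rw [esymmOn_eq_sum, Finset.esymm_map_val, map_sum]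
  exact Finset.sum_congr rfl fun t _ => by simp only [map_prod, eval_X]

theorem eval_perturbedEsymm (hs : s ≤ U.val.map y) (hN : U.card < s.card + N) :
    eval y (perturbedEsymm U s N) = 0 := by
  obtain ⟨t, ht⟩ := Multiset.le_iff_exists_add.1 hs
  have hcard : U.card = s.card + t.card := by
    simpa using congrArg Multiset.card ht
  simp only [perturbedEsymm, map_sum, map_mul, eval_C, eval_esymmOn, ht]
  rw [sum_antidiagonal_esymm_mul_signedHsymm, esymm_eq_zero_of_card_lt (by omega)]

theorem eval_perturbedEsymm_range [CharZero R] {d : ℕ} (hy : ∀ m < d, ∃ j ∈ U, y j = m)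
    (hN : U.card < d + N) :
    eval y (perturbedEsymm U ((Multiset.range d).map Nat.cast) N) = 0 := by
  refine eval_perturbedEsymm ((Multiset.le_iff_subset
    ((Multiset.nodup_range d).map Nat.cast_injective)).2 fun a ha => ?_) (by simpa using hN)
  obtain ⟨m, hm, rfl⟩ := Multiset.mem_map.1 ha
  obtain ⟨j, hj, hjm⟩ := hy m (Multiset.mem_range.1 hm)
  exact Multiset.mem_map.2 ⟨j, hj, hjm⟩

end PerturbedEsymm

/-! ### The points of the ordered set partitions -/

section PartitionPoints

variable {n ℓ : ℕ}

/-- The point of `ℚ ^ n` whose coordinates are the zero-based block positions of `σ`. -/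
noncomputable def OrderedSetPartition.point (σ : OrderedSetPartition n ℓ) : Fin n → ℚ :=
  fun i => (σ.blockIndex i : ℕ)

/-- The points of the ordered set partitions of `[n]` with at least `k` blocks. -/
noncomputable def partitionPoints (n k : ℕ) : Set (Fin n → ℚ) :=
  (fun σ : Σ ℓ, OrderedSetPartition n ℓ => σ.2.point) '' {σ | k ≤ σ.1}

namespace OrderedSetPartition

theorem blockIndex_surjective (σ : OrderedSetPartition n ℓ) : Function.Surjective σ.blockIndex :=
  fun j => (σ.block_nonempty j).imp fun _ => σ.blockIndex_eq

theorem lt_length_iff (σ : OrderedSetPartition n ℓ) {m : ℕ} :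
    m < ℓ ↔ ∃ i, (σ.blockIndex i : ℕ) = m :=
  ⟨fun hm => (σ.blockIndex_surjective ⟨m, hm⟩).imp fun _ => congrArg Fin.val,
    fun ⟨i, hi⟩ => hi ▸ (σ.blockIndex i).2⟩

theorem length_le (σ : OrderedSetPartition n ℓ) : ℓ ≤ n := by
  simpa using Fintype.card_le_of_surjective _ σ.blockIndex_surjective

theorem mem_block_iff (σ : OrderedSetPartition n ℓ) {i : Fin n} {j : Fin ℓ} :
    i ∈ σ.block j ↔ σ.blockIndex i = j :=
  ⟨σ.blockIndex_eq, fun h => h ▸ σ.mem_block_blockIndex i⟩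

theorem sigma_ext {σ τ : Σ ℓ, OrderedSetPartition n ℓ}
    (h : ∀ i, (σ.2.blockIndex i : ℕ) = τ.2.blockIndex i) : σ = τ := by
  obtain ⟨ℓ, σ⟩ := σ
  obtain ⟨ℓ', τ⟩ := τ
  obtain rfl : ℓ = ℓ' := eq_of_forall_lt_iff fun m => by
    simp only [σ.lt_length_iff, τ.lt_length_iff, h]
  have hblock : σ.block = τ.block := by
    ext j i
    rw [mem_block_iff, mem_block_iff, Fin.ext (h i)]
  cases σ
  cases τ
  congr

theorem point_injective :
    Function.Injective fun σ : Σ ℓ, OrderedSetPartition n ℓ => σ.2.point :=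
  fun _ _ h => sigma_ext fun i => Nat.cast_injective (congrFun h i)

end OrderedSetPartition

instance : Finite (Σ ℓ, OrderedSetPartition n ℓ) :=
  Finite.of_injective
    (fun σ : Σ ℓ, OrderedSetPartition n ℓ => fun i => (σ.2.blockIndex i).castLE σ.2.length_le)
    fun _ _ h => OrderedSetPartition.sigma_ext fun i => congrArg Fin.val (congrFun h i)

theorem codeMonomials_eq_image (n k : ℕ) :
    codeMonomials n k = (fun σ : Σ ℓ, OrderedSetPartition n ℓ =>
      ∏ i, (X i : MvPolynomial (Fin n) ℚ) ^ σ.2.boostedCode i) '' {σ | k ≤ σ.1} := by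
  ext p
  constructor
  · rintro ⟨ℓ, σ, hk, rfl⟩
    exact ⟨⟨ℓ, σ⟩, hk, rfl⟩
  · rintro ⟨⟨ℓ, σ⟩, hk, rfl⟩
    exact ⟨ℓ, σ, hk, rfl⟩

theorem codeMonomials_finite (n k : ℕ) : (codeMonomials n k).Finite :=
  codeMonomials_eq_image n k ▸ Set.toFinite _

theorem ncard_codeMonomials_le (n k : ℕ) :
    (codeMonomials n k).ncard ≤ (partitionPoints n k).ncard := by
  rw [codeMonomials_eq_image, partitionPoints,
    Set.ncard_image_of_injective _ OrderedSetPartition.point_injective]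
  exact Set.ncard_image_le (Set.toFinite _)

theorem X_pow_mul_esymmOmit_mem_topFormIdeal {k d r : ℕ} (i : Fin n) (hrd : r ≤ d)
    (hrn : r ≤ n) :
    X i ^ d * esymmOmit n i (n - r) ∈ topFormIdeal (vanishingIdeal ℚ (partitionPoints n k)) := by
  rw [show esymmOmit n i (n - r) = esymmOn (Finset.univ.erase i) (n - r) from
    (esymmOn_eq_sum _ _).symm]
  refine Ideal.subset_span ⟨d + (n - r), _, ?_, (IsTopForm.prod_X_sub_C i d Nat.cast).mul
    (isTopForm_perturbedEsymm (Finset.univ.erase i) ((Multiset.range d).map Nat.cast) (n - r))⟩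
  rw [mem_vanishingIdeal_iff]
  rintro _ ⟨⟨ℓ, σ⟩, -, rfl⟩
  change eval σ.point _ = 0
  rw [map_mul, mul_eq_zero]
  rcases lt_or_ge (σ.blockIndex i : ℕ) d with hid | hdi
  · left
    rw [map_prod]
    refine Finset.prod_eq_zero (Finset.mem_range.2 hid) ?_
    rw [map_sub, eval_X, eval_C, OrderedSetPartition.point, sub_self]
  · right
    refine eval_perturbedEsymm_range (fun m hm => ?_) ?_
    · obtain ⟨j, hj⟩ := σ.lt_length_iff.1 ((hm.trans_le hdi).trans (σ.blockIndex i).2)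
      have hji : j ≠ i := by
        rintro rfl
        omega
      exact ⟨j, Finset.mem_erase.2 ⟨hji, Finset.mem_univ j⟩, congrArg Nat.cast hj⟩
    · rw [Finset.card_erase_of_mem (Finset.mem_univ i), Finset.card_univ, Fintype.card_fin]
      have := i.pos
      omega

theorem esymm_mem_topFormIdeal {k d : ℕ} (hd : n + 1 ≤ d + k) :
    esymm (Fin n) ℚ d ∈ topFormIdeal (vanishingIdeal ℚ (partitionPoints n k)) := by
  rw [show esymm (Fin n) ℚ d = esymmOn Finset.univ d from (esymmOn_eq_sum _ _).symm]
  refine Ideal.subset_span ⟨d, _, ?_,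
    isTopForm_perturbedEsymm Finset.univ ((Multiset.range k).map Nat.cast) d⟩
  rw [mem_vanishingIdeal_iff]
  rintro _ ⟨⟨ℓ, σ⟩, hk, rfl⟩
  change eval σ.point _ = 0
  refine eval_perturbedEsymm_range (fun m hm => ?_) ?_
  · obtain ⟨j, hj⟩ := σ.lt_length_iff.1 (hm.trans_le hk)
    exact ⟨j, Finset.mem_univ j, congrArg Nat.cast hj⟩
  · rw [Finset.card_univ, Fintype.card_fin]
    omega

theorem idealJ_le_topFormIdeal (n k : ℕ) :
    idealJ n k ≤ topFormIdeal (vanishingIdeal ℚ (partitionPoints n k)) := by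
  refine sup_le (Ideal.span_le.2 ?_) (Ideal.span_le.2 ?_)
  · rintro _ ⟨i, d, r, -, hrd, hrn, rfl⟩
    exact X_pow_mul_esymmOmit_mem_topFormIdeal i hrd hrn
  · rintro _ ⟨d, hd, -, rfl⟩
    exact esymm_mem_topFormIdeal hd

theorem ncard_partitionPoints_le_ncard_standardMonomials {k : ℕ} (m : MonomialOrder (Fin n))
    (hfinite : (standardMonomials m (idealJ n k)).Finite) :
    (partitionPoints n k).ncard ≤ (standardMonomials m (idealJ n k)).ncard := by
  refine ncard_le_ncard_of_sub_mem_vanishingIdeal ((Set.toFinite _).image _) hfinite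
    (exists_sub_mem_of_exists_sub_mem_topFormIdeal (fun D r hr =>
      homogeneousComponent_mem_span_of_subset_range_monomial (fun s hs => hs.1) D hr)
      fun p => ?_)
  obtain ⟨r, hr, hpr⟩ := exists_mem_span_standardMonomials_sub_mem m (idealJ n k) p
  exact ⟨r, hr, idealJ_le_topFormIdeal n k hpr⟩

theorem standardMonomials_eq_of_subset {k : ℕ} (m : MonomialOrder (Fin n))
    (h : standardMonomials m (idealJ n k) ⊆ codeMonomials n k) :
    standardMonomials m (idealJ n k) = codeMonomials n k :=
  Set.eq_of_subset_of_ncard_le h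
    ((ncard_codeMonomials_le n k).trans (ncard_partitionPoints_le_ncard_standardMonomials m
      ((codeMonomials_finite n k).subset h)))
    (codeMonomials_finite n k)

end PartitionPoints

/-! ### Decoding a boosted coinversion code -/

section Decoding

variable {α : Type*} [LinearOrder α] {ℓ : ℕ}

theorem exists_greedy_subset (c : α → ℕ) (s : Finset α) :
    ∃ A ⊆ s, ∀ i ∈ s, i ∈ A ↔ c i ≤ numAbove A i := by
  induction s using Finset.induction_on_min with
  | empty => exact ⟨∅, subset_rfl, by simp⟩
  | insert a s has ih =>
    obtain ⟨A, hAs, hA⟩ := ih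
    have haA : a ∉ A := fun h => lt_irrefl a (has a (hAs h))
    by_cases hca : c a ≤ numAbove A a
    · refine ⟨insert a A, Finset.insert_subset_insert a hAs, fun i hi => ?_⟩
      rcases Finset.mem_insert.1 hi with rfl | his
      · simp only [Finset.mem_insert_self, numAbove_insert_of_le le_rfl, hca]
      · rw [numAbove_insert_of_le (has i his).le, ← hA i his, Finset.mem_insert,
          or_iff_right (has i his).ne']
    · refine ⟨A, hAs.trans (Finset.subset_insert a s), fun i hi => ?_⟩
      rcases Finset.mem_insert.1 hi with rfl | his
      · simp only [haA, hca]
      · exact hA i his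

/-- The number of entries of the sequence `μ` exceeding `i` at positions after `j`. When `μ` lists
the block minima, this is the unboosted coinversion count of an element `i` of the block `j`. -/
def numLaterAbove (μ : Fin ℓ → α) (j : Fin ℓ) (i : α) : ℕ :=
  (Finset.univ.filter fun l => j < l ∧ i < μ l).card

theorem numLaterAbove_of_forall_lt {μ : Fin ℓ → α} {j : Fin ℓ} {i : α}
    (h : ∀ l, j < l → i < μ l) : numLaterAbove μ j i = ℓ - 1 - j := by
  rw [numLaterAbove, ← Fin.card_Ioi]
  congr 1
  ext l
  simpa using h l

theorem numLaterAbove_insertNth_self {a : α} {μ : Fin ℓ → α} (h : ∀ l, a < μ l)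
    (p : Fin (ℓ + 1)) : numLaterAbove (p.insertNth a μ : Fin (ℓ + 1) → α) p a = ℓ - p := by
  refine numLaterAbove_of_forall_lt fun l hl => ?_
  obtain ⟨l, rfl⟩ := Fin.exists_succAbove_eq hl.ne'
  simpa using h l

theorem numLaterAbove_insertNth_succAbove {a i : α} (h : a ≤ i) (μ : Fin ℓ → α)
    (p : Fin (ℓ + 1)) (j : Fin ℓ) :
    numLaterAbove (p.insertNth a μ : Fin (ℓ + 1) → α) (p.succAbove j) i = numLaterAbove μ j i := by
  simp only [numLaterAbove, Finset.card_filter]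
  simp [Fin.sum_univ_succAbove _ p, h.not_gt]

theorem exists_enumeration_numLaterAbove_eq {c : α → ℕ} {A : Finset α}
    (hc : ∀ i ∈ A, c i ≤ numAbove A i) :
    ∃ μ : Fin A.card → α, Finset.univ.image μ = A ∧
      ∀ j, numLaterAbove μ j (μ j) = c (μ j) := by
  suffices h : ∀ ℓ, A.card = ℓ → ∃ μ : Fin ℓ → α, Finset.univ.image μ = A ∧
      ∀ j, numLaterAbove μ j (μ j) = c (μ j) from h _ rfl
  induction A using Finset.induction_on_min with
  | empty =>
    rintro _ rfl
    exact ⟨Fin.elim0, rfl, fun j => j.elim0⟩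
  | insert a s has ih =>
    rintro _ rfl
    rw [Finset.card_insert_of_notMem fun h => lt_irrefl a (has a h)]
    obtain ⟨μ, himage, hμ⟩ := ih (fun i hi => by
      simpa only [numAbove_insert_of_le (has i hi).le] using
        hc i (Finset.mem_insert_of_mem hi)) _ rfl
    have hca : c a ≤ s.card := by
      have := hc a (Finset.mem_insert_self a s)
      rw [numAbove_insert_of_le le_rfl] at this
      exact this.trans (Finset.card_filter_le _ _)
    have haμ : ∀ l, a < μ l := fun l =>
      has _ (himage ▸ Finset.mem_image_of_mem μ (Finset.mem_univ l))
    -- Every entry of `μ` exceeds `a`, so `a` is inserted where exactly `c a` entries follow it.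
    set p : Fin (s.card + 1) := ⟨s.card - c a, by omega⟩ with hp
    refine ⟨p.insertNth a μ, ?_, fun j => ?_⟩
    · apply Finset.coe_injective
      rw [Finset.coe_image, Finset.coe_univ, Set.image_univ, Fin.range_insertNth,
        ← Set.image_univ, ← Finset.coe_univ, ← Finset.coe_image, himage, Finset.coe_insert]
      rfl
    · rcases Fin.eq_self_or_eq_succAbove p j with rfl | ⟨j, rfl⟩
      · rw [Fin.insertNth_apply_same, numLaterAbove_insertNth_self haμ]
        simp only [hp]
        omega
      · rw [Fin.insertNth_apply_succAbove, numLaterAbove_insertNth_succAbove (haμ j).le, hμ j]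

theorem numLaterAbove_add_numAbove {μ : Fin ℓ → α} {i : α} (hi : ∀ l, μ l ≠ i) (j : Fin ℓ) :
    numLaterAbove μ j i + numAbove (Finset.univ.filter fun l => μ l < i) j = ℓ - 1 - j := by
  rw [numLaterAbove, numAbove, Finset.filter_filter, ← Fin.card_Ioi,
    ← Finset.card_filter_add_card_filter_not (s := Finset.Ioi j) fun l => i < μ l]
  congr 2 <;> ext l
  · simp
  · simp [(hi l).le_iff_lt, and_comm]

theorem exists_numLaterAbove_add_eq {μ : Fin ℓ → α} {i : α} (hi : ∀ l, μ l ≠ i) {u : ℕ}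
    (hu : (Finset.univ.filter fun l => i < μ l).card < u) (huℓ : u ≤ ℓ) :
    ∃ j, μ j < i ∧ numLaterAbove μ j i + (j + 1) = u := by
  have hsplit := Finset.card_filter_add_card_filter_not (s := Finset.univ) fun l => i < μ l
  simp only [not_lt, (hi _).le_iff_lt, Finset.card_univ, Fintype.card_fin] at hsplit
  obtain ⟨j, hj, hju⟩ := exists_numAbove_eq (A := Finset.univ.filter fun l => μ l < i)
    (v := ℓ - u) (by omega)
  have := numLaterAbove_add_numAbove hi j
  exact ⟨j, (Finset.mem_filter.1 hj).2, by omega⟩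

end Decoding

namespace OrderedSetPartition

variable {n ℓ : ℕ}

/-- The ordered set partition whose blocks are the fibres of `b`. -/
def ofIndex (b : Fin n → Fin ℓ) (hb : Function.Surjective b) : OrderedSetPartition n ℓ where
  block j := Finset.univ.filter fun i => b i = j
  block_nonempty j := (hb j).imp fun i hi => by simpa using hi
  existsUnique_mem i := ⟨b i, by simp, fun j hj => by simpa [eq_comm] using hj⟩

variable {b : Fin n → Fin ℓ} {hb : Function.Surjective b}

theorem mem_block_ofIndex {i : Fin n} {j : Fin ℓ} : i ∈ (ofIndex b hb).block j ↔ b i = j := by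
  simp [ofIndex]

theorem blockIndex_ofIndex : (ofIndex b hb).blockIndex = b :=
  funext fun _ => blockIndex_eq _ (mem_block_ofIndex.2 rfl)

theorem blockMin_ofIndex {μ : Fin ℓ → Fin n} (hbμ : ∀ j, b (μ j) = j) (hμb : ∀ i, μ (b i) ≤ i) :
    (ofIndex b hb).blockMin = μ := by
  refine funext fun j => le_antisymm (Finset.min'_le _ _ (mem_block_ofIndex.2 (hbμ j)))
    (Finset.le_min' _ _ _ fun i hi => ?_)
  rw [← mem_block_ofIndex.1 hi]
  exact hμb i

theorem boostedCode_ofIndex {μ : Fin ℓ → Fin n} (hbμ : ∀ j, b (μ j) = j)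
    (hμb : ∀ i, μ (b i) ≤ i) (i : Fin n) : (ofIndex b hb).boostedCode i =
      numLaterAbove μ (b i) i + if i = μ (b i) then 0 else (b i : ℕ) + 1 := by
  rw [boostedCode, blockIndex_ofIndex, blockMin_ofIndex hbμ hμb, numLaterAbove]

end OrderedSetPartition

theorem exists_boostedCode_eq {n : ℕ} {c : Fin n → ℕ} {A : Finset (Fin n)}
    (hA : ∀ i, i ∈ A ↔ c i ≤ numAbove A i) (hc : ∀ i, c i ≤ A.card) :
    ∃ σ : OrderedSetPartition n A.card, σ.boostedCode = c := by
  obtain ⟨μ, himage, hμ⟩ := exists_enumeration_numLaterAbove_eq fun i hi => (hA i).1 hi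
  have hinjective : Function.Injective μ := by
    rw [← Set.injOn_univ, ← Finset.coe_univ, ← Finset.card_image_iff, himage, Finset.card_univ,
      Fintype.card_fin]
  have hnumAbove : ∀ i, (Finset.univ.filter fun l => i < μ l).card = numAbove A i := fun i => by
    conv_rhs => rw [← himage, numAbove, Finset.filter_image]
    exact (Finset.card_image_of_injective _ hinjective).symm
  have hblock : ∀ i, ∃ j, (∀ l, μ l = i → j = l) ∧ μ j ≤ i ∧
      (numLaterAbove μ j i + if i = μ j then 0 else (j : ℕ) + 1) = c i := fun i => by
    by_cases hi : i ∈ A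
    · obtain ⟨j, -, rfl⟩ := Finset.mem_image.1 (himage.symm ▸ hi)
      exact ⟨j, fun l hl => hinjective hl.symm, le_rfl, by rw [if_pos rfl, add_zero, hμ j]⟩
    · have hne : ∀ l, μ l ≠ i := fun l hl =>
        hi (himage ▸ hl ▸ Finset.mem_image_of_mem μ (Finset.mem_univ l))
      obtain ⟨j, hji, hj⟩ := exists_numLaterAbove_add_eq hne (u := c i)
        (by rw [hnumAbove]; exact not_le.1 fun h => hi ((hA i).2 h)) (hc i)
      exact ⟨j, fun l hl => absurd hl (hne l), hji.le, by rw [if_neg (hne j).symm, hj]⟩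
  choose b hbμ hμb hcode using hblock
  have hsection : ∀ j, b (μ j) = j := fun j => hbμ _ j rfl
  exact ⟨.ofIndex b fun j => ⟨μ j, hsection j⟩, funext fun i =>
    (OrderedSetPartition.boostedCode_ofIndex hsection hμb i).trans (hcode i)⟩

/-! ### Monomials that are not codes are leading monomials -/

section LeadingMonomials

variable {n : ℕ}

theorem esymmOn_univ_mem_idealJ {k d : ℕ} (hd : n + 1 ≤ d + k) :
    esymmOn Finset.univ d ∈ idealJ n k := by
  rcases le_or_gt d n with hdn | hnd
  · exact Ideal.mem_sup_right (Ideal.subset_span ⟨d, hd, hdn, esymmOn_eq_sum _ _⟩)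
  · rw [esymmOn_eq_zero_of_card_lt (by simpa using hnd)]
    exact Ideal.zero_mem _

theorem X_pow_mul_esymmOn_mem_idealJ (k : ℕ) {d e : ℕ} (i : Fin n) (h : n ≤ e + d) :
    X i ^ d * esymmOn (Finset.univ.erase i) e ∈ idealJ n k := by
  rcases lt_or_ge e n with hen | hne
  · refine Ideal.mem_sup_left (Ideal.subset_span
      ⟨i, d, n - e, by omega, by omega, Nat.sub_le n e, ?_⟩)
    rw [Nat.sub_sub_self hen.le, esymmOn_eq_sum, esymmOmit]
  · have hcard : (Finset.univ.erase i).card < e := by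
      rw [Finset.card_erase_of_mem (Finset.mem_univ i), Finset.card_univ, Fintype.card_fin]
      have := i.pos
      omega
    rw [esymmOn_eq_zero_of_card_lt hcard, mul_zero]
    exact Ideal.zero_mem _

theorem sum_single_le {ι : Type*} {T : Finset ι} {g : ι → ℕ} {c : ι →₀ ℕ}
    (h : ∀ i ∈ T, g i ≤ c i) : ∑ i ∈ T, Finsupp.single i (g i) ≤ c := by
  classical
  intro i
  rw [Finsupp.finsetSum_apply]
  simp only [Finsupp.single_apply, Finset.sum_ite_eq']
  split_ifs with hi
  · exact h i hi
  · exact Nat.zero_le _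

variable {c : Fin n →₀ ℕ} {A : Finset (Fin n)}

theorem monomial_mem_leadingMonomialIdeal_of_card_lt {k : ℕ}
    (hA : ∀ i ∉ A, numAbove A i < c i) (hk : A.card < k) :
    monomial c 1 ∈ leadingMonomialIdeal (lexOrder n) (idealJ n k) := by
  obtain ⟨f, hf, hf0, hdegree⟩ := exists_degree_eq_skip (Finset.subset_univ Aᶜ)
    fun d hd => esymmOn_univ_mem_idealJ (n := n) (k := k) (by
      rw [Finset.card_compl, Fintype.card_fin] at hd
      omega)
  refine (monomial_mem_leadingMonomialIdeal_iff _ _).2 ⟨f, hf, hf0, hdegree ▸ sum_single_le ?_⟩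
  simpa [Nat.succ_le_iff, ← Finset.compl_eq_univ_sdiff] using hA

theorem monomial_mem_leadingMonomialIdeal_of_card_lt_apply (k : ℕ)
    (hA : ∀ i ∉ A, numAbove A i < c i) {i : Fin n} (hi : i ∉ A) (hc : A.card < c i) :
    monomial c 1 ∈ leadingMonomialIdeal (lexOrder n) (idealJ n k) := by
  obtain ⟨f, hf, hf0, hdegree⟩ := exists_degree_eq_skip
    (Finset.erase_subset_erase i (Finset.subset_univ Aᶜ))
    (I := Submodule.comap (LinearMap.mulLeft _ (X i ^ c i)) (idealJ n k)) fun d hd =>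
      X_pow_mul_esymmOn_mem_idealJ k i (by
        rw [Finset.card_erase_of_mem (Finset.mem_compl.2 hi), Finset.card_compl,
          Fintype.card_fin] at hd
        omega)
  have hX : (X i ^ c i : MvPolynomial (Fin n) ℚ) ≠ 0 := pow_ne_zero _ (X_ne_zero i)
  refine (monomial_mem_leadingMonomialIdeal_iff _ _).2
    ⟨X i ^ c i * f, hf, mul_ne_zero hX hf0, ?_⟩
  have hsdiff : Finset.univ.erase i \ Aᶜ.erase i = A := by
    ext j
    by_cases hj : j = i
    · simp [hj, hi]
    · simp [hj]
  rw [MonomialOrder.degree_mul hX hf0, MonomialOrder.degree_pow, MonomialOrder.degree_X, hdegree,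
    hsdiff, Finsupp.smul_single_one]
  convert sum_single_le (T := Aᶜ) (g := fun j => if j = i then c i else numAbove A j + 1) ?_ using 1
  · rw [← Finset.add_sum_erase _ _ (Finset.mem_compl.2 hi), if_pos rfl]
    congr 1
    exact Finset.sum_congr rfl fun j hj => by rw [if_neg (Finset.ne_of_mem_erase hj)]
  · intro j hj
    split_ifs with hji
    · rw [hji]
    · exact hA j (Finset.mem_compl.1 hj)

end LeadingMonomials

theorem standardMonomials_subset_codeMonomials (n k : ℕ) :
    standardMonomials (lexOrder n) (idealJ n k) ⊆ codeMonomials n k := by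
  rintro _ ⟨⟨c, rfl⟩, hstandard⟩
  obtain ⟨A, -, hA⟩ := exists_greedy_subset c Finset.univ
  replace hA : ∀ i, i ∈ A ↔ c i ≤ numAbove A i := fun i => hA i (Finset.mem_univ i)
  have hnumAbove : ∀ i ∉ A, numAbove A i < c i := fun i hi => not_le.1 fun h => hi ((hA i).2 h)
  have hk : k ≤ A.card := not_lt.1 fun h =>
    hstandard (monomial_mem_leadingMonomialIdeal_of_card_lt hnumAbove h)
  have hcard : ∀ i, c i ≤ A.card := fun i => not_lt.1 fun h => by
    by_cases hi : i ∈ A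
    · exact h.not_ge (((hA i).1 hi).trans (Finset.card_filter_le _ _))
    · exact hstandard (monomial_mem_leadingMonomialIdeal_of_card_lt_apply k hnumAbove hi h)
  obtain ⟨σ, hσ⟩ := exists_boostedCode_eq hA hcard
  refine ⟨_, σ, hk, ?_⟩
  rw [hσ, monomial_eq, C_1, one_mul, Finsupp.prod_fintype _ _ fun i => pow_zero _]

end StdMonomials

theorem mainTheorem5 (n k : ℕ) (hk : 1 ≤ k) (hkn : k ≤ n) :
    StdMonomials.standardMonomials (StdMonomials.lexOrder n) (StdMonomials.idealJ n k) =
        StdMonomials.codeMonomials n k ∧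
      ∃ b : Module.Basis (StdMonomials.codeMonomials n k) ℚ (StdMonomials.QuotientS n k),
        ∀ p : StdMonomials.codeMonomials n k,
          b p = Ideal.Quotient.mk (StdMonomials.idealJ n k) (p : MvPolynomial (Fin n) ℚ) := by
  have h := StdMonomials.standardMonomials_eq_of_subset _
    (StdMonomials.standardMonomials_subset_codeMonomials n k)
  refine ⟨h, ?_⟩
  rw [← h]
  exact StdMonomials.exists_basis_standardMonomials _ _
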